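/- For $t,s\ge 0$ put $d=t+s$ and $\ell=[d/2]$ (integer part). Let $\mathcal C_{t,s}$ be the real Clifford algebra of signature $(t,s)$, i.e. the unital associative $\mathbb R$-algebra generated by $e_1,\dots,e_d$ subject to $e_Me_N+e_Ne_M=2\eta_{MN}$, where $\eta=\mathrm{Diag}(1,\dots,1,-1,\dots,-1)$ with $t$ entries $1$ and $s$ entries $-1$; equivalently, the Clifford algebra (with $v^2=Q(v)$) of the quadratic form $Q(x)=x_1^2+\dots+x_t^2-x_{t+1}^2-\dots-x_d^2$ on $\mathbb R^d$. Let $\mathcal M_n(\mathbb F)$ be the $\mathbb R$-algebra of $n\times n$ matrices over $\mathbb F=\mathbb R,\mathbb C$ or $\mathbb H$. All isomorphisms below are isomorphisms of $\mathbb R$-algebras. (1) The algebra $\mathcal C_{t,s}$ is given, according to $t-s$ mod $8$, by the following table: $$\begin{array}{c|l} t-s \bmod 8 & \mathcal C_{t,s}\\ \hline 0 & \mathcal M_{2^{\ell}}(\mathbb R)\\ 1 & \mathcal M_{2^{\ell}}(\mathbb R)\oplus\mathcal M_{2^{\ell}}(\mathbb R)\\ 2 & \mathcal M_{2^{\ell}}(\mathbb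 R)\\ 3 & \mathcal M_{2^{\ell}}(\mathbb C)\\ 4 & \mathcal M_{2^{\ell-1}}(\mathbb H)\\ 5 & \mathcal M_{2^{\ell-1}}(\mathbb H)\oplus\mathcal M_{2^{\ell-1}}(\mathbb H)\\ 6 & \mathcal M_{2^{\ell-1}}(\mathbb H)\\ 7 & \mathcal M_{2^{\ell}}(\mathbb C) \end{array}$$ (in the rows $4,5,6$ one has $\ell\ge 1$). In particular, which of the forms occurs depends only on $t-s$ mod $8$. (2) The Clifford algebra of any non-degenerate quadratic form of signature $(t,s)$ on a finite-dimensional real vector space is isomorphic to $\mathcal C_{t,s}$. (3) $\mathcal C_{0,0}\cong\mathbb R$, $\mathcal C_{1,0}\cong\mathbb R\oplus\mathbb R$, $\mathcal C_{0,1}\cong\mathbb C$, $\mathcal C_{2,0}\cong\mathcal M_2(\mathbb R)$, $\mathcal C_{1,1}\cong\mathcal M_2(\mathbb R)$, $\mathcal C_{0,2}\cong\mathbb H$. (4) For all $d\ge0$, $\mathcal C_{d+8,0}\cong\mathcal C_{d,0}\otimes_{\mathbb R}\mathcal M_{16}(\mathbb R)$ and $\mathcal C_{0,d+8}\cong\mathcal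 C_{0,d}\otimes_{\mathbb R}\mathcal M_{16}(\mathbb R)$. (5) For all $t\ge s\ge0$, $\mathcal C_{t,s}\cong\mathcal C_{t-s,0}\otimes_{\mathbb R}\mathcal M_{2^s}(\mathbb R)$. -/

import Mathlib

open scoped TensorProduct Quaternion

noncomputable section

/-- The standard real quadratic form of signature `(t, s)`, namely
`x₁² + ⋯ + x_t² - y₁² - ⋯ - y_s²` on `ℝ^t × ℝ^s` (coordinates indexed by `Fin t ⊕ Fin s`). -/
def stdForm (t s : ℕ) : QuadraticForm ℝ (Fin t ⊕ Fin s → ℝ) :=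
  QuadraticMap.weightedSumSquares ℝ
    (Sum.elim (fun _ : Fin t => (1 : ℝ)) (fun _ : Fin s => (-1 : ℝ)))

/-- The real Clifford algebra `C_{t,s}`: `t` generators of square `1` and `s` generators of
square `-1`, pairwise anticommuting (convention `v * v = Q v`). -/
abbrev RealClifford (t s : ℕ) : Type := CliffordAlgebra (stdForm t s)

/-- The algebra of `n × n` matrices over `F`. -/
abbrev Mat (n : ℕ) (F : Type) : Type := Matrix (Fin n) (Fin n) F

end

/-!
Everything rests on one isomorphism, `CliffordPlane.sumFormEquiv`. Let `q = c₁ x² + c₂ y²` be a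
plane with `c₁, c₂ = ±1` and let `e₁, e₂` be its generators. The product `e₁ e₂` anticommutes with
the plane and has square `-c₁ c₂`. Hence `(p, v) ↦ 1 ⊗ p + v ⊗ e₁ e₂` satisfies the Clifford
relation of `q ⊥ (-c₁ c₂) Q`, and it induces `Cl(q ⊥ (-c₁ c₂) Q) ≅ Cl(Q) ⊗ Cl(q)`. As `Cl(q)` is a
quaternion algebra, split unless `c₁ = c₂ = -1`, the three choices of signs read

* `C_{t+1,s+1} ≅ C_{t,s} ⊗ M₂(ℝ)` (`nonempty_realClifford_succ_succ`),
* `C_{t+2,s} ≅ C_{s,t} ⊗ M₂(ℝ)` (`nonempty_realClifford_add_two_left`),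
* `C_{t,s+2} ≅ C_{s,t} ⊗ ℍ` (`nonempty_realClifford_add_two_right`).

Iterating the first gives the reduction to definite signature. Composing the last two in either
order gives `C_{t+4,s} ≅ C_{t,s+4}` (`nonempty_realClifford_add_four`), so that
`C_{t+8,s} ≅ C_{t+4,s+4} ≅ C_{t,s} ⊗ M₁₆(ℝ)`: the periodicity follows from the hyperbolic
reduction alone, and `ℍ ⊗ ℍ ≅ M₄(ℝ)` is not needed.

For the table, tensoring with `M₂(ℝ)` keeps the row and raises `ℓ` by one, and the table is
symmetric under `t - s ↦ 2 - (t - s)`, which is what `C_{t+2,s} ≅ C_{s,t} ⊗ M₂(ℝ)` requires. The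
relations above reduce every entry to `C_{0,0}`, `C_{1,0}`, `C_{0,1}`, `C_{0,2}` and `C_{0,3}`
(`isTableEntry_realClifford`). Independence of the choice of form is Sylvester's law of inertia
(`equivalent_stdForm`).
-/

section

open CliffordAlgebra QuadraticMap

/-! ### The Clifford algebra of an orthogonal sum with a plane -/

namespace CliffordPlane

variable {R M : Type*} [CommRing R] [AddCommGroup M] [Module R M]
variable (c₁ c₂ : R)

local notation "qᵖ" => CliffordAlgebraQuaternion.Q c₁ c₂

/-- The product `e₁ e₂` of the two generators in the Clifford algebra of the plane form
`c₁ x² + c₂ y²`. -/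
def vol : CliffordAlgebra qᵖ :=
  ι qᵖ (1, 0) * ι qᵖ (0, 1)

theorem ι_mul_ι_swap : ι qᵖ (0, 1) * ι qᵖ (1, 0) = -(ι qᵖ (1, 0) * ι qᵖ (0, 1)) := by
  refine ι_mul_ι_comm_of_isOrtho ?_
  simp [QuadraticMap.IsOrtho, add_comm]

theorem ι_left_mul_self : ι qᵖ (1, 0) * ι qᵖ (1, 0) = algebraMap R _ c₁ := by
  rw [ι_sq_scalar]; simp

theorem ι_right_mul_self : ι qᵖ (0, 1) * ι qᵖ (0, 1) = algebraMap R _ c₂ := by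
  rw [ι_sq_scalar]; simp

theorem vol_mul_vol : vol c₁ c₂ * vol c₁ c₂ = algebraMap R _ (-(c₁ * c₂)) := by
  rw [vol, mul_assoc, ← mul_assoc (ι _ (0, 1)), ι_mul_ι_swap, neg_mul, mul_neg, mul_assoc,
    ι_right_mul_self, ← mul_assoc, ι_left_mul_self, map_neg, map_mul]

theorem vol_mul_ι (p : R × R) : vol c₁ c₂ * ι qᵖ p = -(ι qᵖ p * vol c₁ c₂) := by
  have hp : ι qᵖ p = p.1 • ι qᵖ (1, 0) + p.2 • ι qᵖ (0, 1) := by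
    rw [← map_smul, ← map_smul, ← map_add]
    simp
  have h₁ : vol c₁ c₂ * ι qᵖ (1, 0) = -(ι qᵖ (1, 0) * vol c₁ c₂) := by
    rw [vol, mul_assoc, ι_mul_ι_swap, mul_neg]
  have h₂ : vol c₁ c₂ * ι qᵖ (0, 1) = -(ι qᵖ (0, 1) * vol c₁ c₂) := by
    rw [vol, ← mul_assoc (ι qᵖ (0, 1)), ι_mul_ι_swap, neg_mul, neg_neg]
  rw [hp, mul_add, add_mul, mul_smul_comm, mul_smul_comm, h₁, h₂, smul_mul_assoc, smul_mul_assoc,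
    smul_neg, smul_neg, neg_add]

variable (Q : QuadraticForm R M)

/-- The form `q ⊥ (-c₁ c₂) Q`, where `q = c₁ x² + c₂ y²`. -/
abbrev sumForm : QuadraticForm R ((R × R) × M) := (qᵖ).prod ((-(c₁ * c₂)) • Q)

local notation "qˢ" => sumForm c₁ c₂ Q

/-- The algebra map `Cl(q ⊥ (-c₁ c₂) Q) → Cl(Q) ⊗ Cl(q)` sending `(p, v)` to
`1 ⊗ p + v ⊗ e₁ e₂`. -/
def toTensor : CliffordAlgebra qˢ →ₐ[R] CliffordAlgebra Q ⊗[R] CliffordAlgebra qᵖ :=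
  lift qˢ ⟨LinearMap.coprod
      ((Algebra.TensorProduct.includeRight).toLinearMap ∘ₗ ι qᵖ)
      ((TensorProduct.mk R _ _).flip (vol c₁ c₂) ∘ₗ ι Q), fun x => by
    simp only [LinearMap.coprod_apply, LinearMap.comp_apply, AlgHom.toLinearMap_apply,
      Algebra.TensorProduct.includeRight_apply, LinearMap.flip_apply, TensorProduct.mk_apply,
      add_mul, mul_add, Algebra.TensorProduct.tmul_mul_tmul, one_mul, mul_one, ι_sq_scalar,
      vol_mul_vol, vol_mul_ι, TensorProduct.tmul_neg, QuadraticMap.prod_apply,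
      smul_apply, map_add, Algebra.algebraMap_eq_smul_one,
      Algebra.TensorProduct.one_def, TensorProduct.tmul_smul, TensorProduct.smul_tmul', smul_smul,
      smul_eq_mul]
    abel⟩

theorem toTensor_ι (p : R × R) (v : M) :
    toTensor c₁ c₂ Q (ι qˢ (p, v)) = 1 ⊗ₜ ι qᵖ p + ι Q v ⊗ₜ vol c₁ c₂ := by
  rw [toTensor, lift_ι_apply]
  rfl

/-- The image of `e₁ e₂` in the Clifford algebra of `q ⊥ (-c₁ c₂) Q`. -/
def sumVol : CliffordAlgebra qˢ := map (QuadraticMap.Isometry.inl _ _) (vol c₁ c₂)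

theorem sumVol_mul_sumVol :
    sumVol c₁ c₂ Q * sumVol c₁ c₂ Q = algebraMap R _ (-(c₁ * c₂)) := by
  rw [sumVol, ← map_mul, vol_mul_vol, AlgHom.commutes]

theorem ι_inr_mul_ι_inl (p : R × R) (v : M) :
    ι qˢ (0, v) * ι qˢ (p, 0) = -(ι qˢ (p, 0) * ι qˢ (0, v)) := by
  refine ι_mul_ι_comm_of_isOrtho ?_
  simp [QuadraticMap.IsOrtho, add_comm]

theorem sumVol_mul_ι_inl (p : R × R) :
    sumVol c₁ c₂ Q * ι qˢ (p, 0) = -(ι qˢ (p, 0) * sumVol c₁ c₂ Q) := by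
  have := congrArg (map (QuadraticMap.Isometry.inl qᵖ ((-(c₁ * c₂)) • Q))) (vol_mul_ι c₁ c₂ p)
  simpa [map_apply_ι, sumVol] using this

theorem sumVol_mul_ι_inr (v : M) :
    sumVol c₁ c₂ Q * ι qˢ (0, v) = ι qˢ (0, v) * sumVol c₁ c₂ Q := by
  have h : sumVol c₁ c₂ Q = ι qˢ ((1, 0), 0) * ι qˢ ((0, 1), 0) := by
    simp [sumVol, vol, map_apply_ι]
  rw [h, ← mul_assoc, ι_inr_mul_ι_inl, neg_mul, mul_assoc, mul_assoc, ι_inr_mul_ι_inl, mul_neg,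
    neg_neg]

variable {c₁ c₂} (hc : (c₁ * c₂) * (c₁ * c₂) = 1)

/-- For `(c₁ c₂)² = 1`, the algebra map `Cl(Q) → Cl(q ⊥ (-c₁ c₂) Q)` sending `v` to
`-c₁ c₂ e₁ e₂ v`. Since `(e₁ e₂)² = -c₁ c₂`, the coefficient makes `v ⊗ e₁ e₂` and `v` correspond
under `toTensor`. -/
def ofLeft : CliffordAlgebra Q →ₐ[R] CliffordAlgebra qˢ :=
  lift Q ⟨(-(c₁ * c₂)) • LinearMap.mulLeft R (sumVol c₁ c₂ Q) ∘ₗ ι qˢ ∘ₗ LinearMap.inr R _ _,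
    fun v => by
      have h : (sumVol c₁ c₂ Q * ι qˢ (0, v)) * (sumVol c₁ c₂ Q * ι qˢ (0, v)) =
          algebraMap R _ (Q v) := by
        rw [mul_assoc, ← mul_assoc (ι qˢ (0, v)), ← sumVol_mul_ι_inr, mul_assoc, ← mul_assoc,
          ι_sq_scalar, sumVol_mul_sumVol, ← map_mul]
        congr 1
        simp only [QuadraticMap.prod_apply, map_zero, smul_apply, smul_eq_mul, zero_add]
        linear_combination Q v * hc
      simp [h, smul_smul, hc]⟩

theorem ofLeft_ι (v : M) :
    ofLeft Q hc (ι Q v) = (-(c₁ * c₂)) • (sumVol c₁ c₂ Q * ι qˢ (0, v)) := by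
  rw [ofLeft, lift_ι_apply]
  rfl

theorem commute_ofLeft (x : CliffordAlgebra Q) (y : CliffordAlgebra qᵖ) :
    Commute (ofLeft Q hc x) (map (QuadraticMap.Isometry.inl _ _) y) := by
  induction x using CliffordAlgebra.induction with
  | algebraMap r => rw [AlgHom.commutes]; exact Algebra.commutes r _
  | add a b ha hb => rw [map_add]; exact ha.add_left hb
  | mul a b ha hb => rw [map_mul]; exact ha.mul_left hb
  | ι v =>
    induction y using CliffordAlgebra.induction with
    | algebraMap r => rw [AlgHom.commutes]; exact (Algebra.commutes r _).symm
    | add a b ha hb => rw [map_add]; exact ha.add_right hb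
    | mul a b ha hb => rw [map_mul]; exact ha.mul_right hb
    | ι p =>
      rw [ofLeft_ι, map_apply_ι, QuadraticMap.Isometry.inl_apply]
      refine Commute.smul_left ?_ _
      -- both `e₁ e₂` and `v` anticommute with the plane
      rw [Commute, SemiconjBy, mul_assoc, ι_inr_mul_ι_inl, mul_neg, ← mul_assoc,
        sumVol_mul_ι_inl, neg_mul, neg_neg, mul_assoc]

/-- The inverse `Cl(Q) ⊗ Cl(q) → Cl(q ⊥ (-c₁ c₂) Q)` of `toTensor`. -/
def ofTensor : CliffordAlgebra Q ⊗[R] CliffordAlgebra qᵖ →ₐ[R] CliffordAlgebra qˢ :=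
  Algebra.TensorProduct.lift (ofLeft Q hc) (map (QuadraticMap.Isometry.inl _ _))
    (commute_ofLeft Q hc)

/-- If `(c₁ c₂)² = 1` and `q = c₁ x² + c₂ y²`, then `Cl(q ⊥ (-c₁ c₂) Q) ≅ Cl(Q) ⊗ Cl(q)`. -/
def sumFormEquiv : CliffordAlgebra qˢ ≃ₐ[R] CliffordAlgebra Q ⊗[R] CliffordAlgebra qᵖ :=
  AlgEquiv.ofAlgHom (toTensor c₁ c₂ Q) (ofTensor Q hc)
    (by
      have hvol : toTensor c₁ c₂ Q (sumVol c₁ c₂ Q) = 1 ⊗ₜ vol c₁ c₂ := by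
        simp [sumVol, vol, map_apply_ι, toTensor_ι]
      apply Algebra.TensorProduct.ext
      · ext v
        simp [ofTensor, ofLeft_ι, hvol, toTensor_ι, vol_mul_vol, Algebra.algebraMap_eq_smul_one,
          TensorProduct.tmul_neg, smul_smul, hc]
      · ext <;> simp [ofTensor, map_apply_ι, toTensor_ι])
    (by
      have h : ∀ x : (R × R) × M, ofTensor Q hc (toTensor c₁ c₂ Q (ι qˢ x)) = ι qˢ x := by
        rintro ⟨p, v⟩
        have hv : ofLeft Q hc (ι Q v) * sumVol c₁ c₂ Q = ι qˢ (0, v) := by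
          rw [ofLeft_ι, smul_mul_assoc, sumVol_mul_ι_inr, mul_assoc, sumVol_mul_sumVol,
            ← Algebra.commutes, ← Algebra.smul_def, smul_smul]
          simp [hc]
        have hp : (p, v) = (p, 0) + (0, v) := by simp
        rw [toTensor_ι, map_add, ofTensor, Algebra.TensorProduct.lift_tmul,
          Algebra.TensorProduct.lift_tmul, map_one, one_mul, map_apply_ι,
          QuadraticMap.Isometry.inl_apply, ← sumVol, hv, hp, map_add]
      apply CliffordAlgebra.hom_ext
      exact LinearMap.ext h)

end CliffordPlane

/-! ### Diagonal real forms with entries `±1` -/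

section QuadraticForm

variable {ι κ : Type*} [Fintype ι] [Fintype κ]

theorem weightedSumSquares_equivalent_of_reindex (e : ι ≃ κ) {w : ι → ℝ} {w' : κ → ℝ}
    (h : ∀ i, w' (e i) = w i) :
    (weightedSumSquares ℝ w).Equivalent (weightedSumSquares ℝ w') :=
  ⟨{ LinearEquiv.funCongrLeft ℝ ℝ e.symm with
    map_app' := fun v => by
      simp only [weightedSumSquares_apply]
      rw [← e.sum_comp]
      simp [h, LinearEquiv.funCongrLeft, LinearMap.funLeft] }⟩

theorem weightedSumSquares_sumElim_equivalent (w : ι → ℝ) (w' : κ → ℝ) :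
    (weightedSumSquares ℝ (Sum.elim w w')).Equivalent
      ((weightedSumSquares ℝ w).prod (weightedSumSquares ℝ w')) :=
  ⟨{ LinearEquiv.sumArrowLequivProdArrow ι κ ℝ ℝ with
    map_app' := fun v => by
      simp [LinearEquiv.sumArrowLequivProdArrow, Equiv.sumArrowEquivProdArrow] }⟩

theorem weightedSumSquares_fin_two_equivalent (w : Fin 2 → ℝ) :
    (weightedSumSquares ℝ w).Equivalent (CliffordAlgebraQuaternion.Q (w 0) (w 1)) :=
  ⟨{ LinearEquiv.finTwoArrow ℝ ℝ with
    map_app' := fun v => by simp [LinearEquiv.finTwoArrow] }⟩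

/-- Sylvester's normal form: a diagonal form with entries `±1` is determined up to isometry by
the number of entries of each sign. -/
theorem weightedSumSquares_equivalent_stdForm {w : ι → ℝ} (hw : ∀ i, w i = 1 ∨ w i = -1) {t s : ℕ}
    (ht : ∑ i, (if w i = 1 then 1 else 0) = t) (hs : ∑ i, (if w i = -1 then 1 else 0) = s) :
    (weightedSumSquares ℝ w).Equivalent (stdForm t s) := by
  classical
  have hneg : ∀ i, w i = -1 ↔ ¬ w i = 1 := fun i => by
    rcases hw i with h | h <;> rw [h] <;> norm_num
  have e₁ : {i // w i = 1} ≃ Fin t := Fintype.equivFinOfCardEq (by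
    rw [Fintype.card_subtype, ← ht, Finset.card_filter])
  have e₂ : {i // ¬ w i = 1} ≃ Fin s := Fintype.equivFinOfCardEq (by
    simp only [Fintype.card_subtype, ← hs, Finset.card_filter, hneg])
  have h := weightedSumSquares_equivalent_of_reindex
    (w := Sum.elim (fun _ : Fin t => (1 : ℝ)) (fun _ : Fin s => (-1 : ℝ))) (w' := w)
    ((Equiv.sumCongr e₁ e₂).symm.trans (Equiv.sumCompl fun i => w i = 1)) (by
      rintro (i | i)
      · exact (e₁.symm i).2
      · exact (hneg _).2 (e₂.symm i).2)
  exact h.symm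

/-- The form obtained from a standard form by adjoining a plane with entries `±1`, after
multiplying the standard form by `ε = ±1`, which swaps its signature if `ε = -1`. -/
theorem prod_smul_stdForm_equivalent {c₁ c₂ ε : ℝ} (h₁ : c₁ = 1 ∨ c₁ = -1)
    (h₂ : c₂ = 1 ∨ c₂ = -1) (hε : ε = 1 ∨ ε = -1) (a b : ℕ) {t s : ℕ}
    (ht : (if c₁ = 1 then 1 else 0) + (if c₂ = 1 then 1 else 0) + (if ε = 1 then a else b) = t)
    (hs : (if c₁ = 1 then 0 else 1) + (if c₂ = 1 then 0 else 1) + (if ε = 1 then b else a) = s) :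
    ((CliffordAlgebraQuaternion.Q c₁ c₂).prod (ε • stdForm a b)).Equivalent (stdForm t s) := by
  have h : (-1 : ℝ) ≠ 1 := by norm_num
  have h' : (1 : ℝ) ≠ -1 := by norm_num
  have hsmul : ε • stdForm a b = weightedSumSquares ℝ
      (ε • Sum.elim (fun _ : Fin a => (1 : ℝ)) (fun _ : Fin b => (-1 : ℝ))) := by
    ext v
    simp only [stdForm, smul_apply, weightedSumSquares_apply, Finset.smul_sum, Pi.smul_apply,
      smul_assoc]
  rw [hsmul]
  refine (((weightedSumSquares_fin_two_equivalent ![c₁, c₂]).symm.prod (Equivalent.refl _)).trans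
    (weightedSumSquares_sumElim_equivalent _ _).symm).trans
    (weightedSumSquares_equivalent_stdForm ?_ ?_ ?_)
  · rintro (i | i | i)
    · fin_cases i <;> simpa
    · simpa using hε
    · simpa [neg_eq_iff_eq_neg, or_comm] using hε
  · rw [← ht]
    rcases h₁ with rfl | rfl <;> rcases h₂ with rfl | rfl <;> rcases hε with rfl | rfl <;>
      simp [-Finset.sum_boole, h]
  · rw [← hs]
    rcases h₁ with rfl | rfl <;> rcases h₂ with rfl | rfl <;> rcases hε with rfl | rfl <;>
      simp [-Finset.sum_boole, h, h']

/-- The plane `Q c₁ c₂` with entries `±1` is a standard form. -/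
theorem quaternionForm_equivalent_stdForm {c₁ c₂ : ℝ} (h₁ : c₁ = 1 ∨ c₁ = -1)
    (h₂ : c₂ = 1 ∨ c₂ = -1) {t s : ℕ}
    (ht : (if c₁ = 1 then 1 else 0) + (if c₂ = 1 then 1 else 0) = t)
    (hs : (if c₁ = 1 then 0 else 1) + (if c₂ = 1 then 0 else 1) = s) :
    (CliffordAlgebraQuaternion.Q c₁ c₂).Equivalent (stdForm t s) := by
  have h : (-1 : ℝ) ≠ 1 := by norm_num
  have h' : (1 : ℝ) ≠ -1 := by norm_num
  refine (weightedSumSquares_fin_two_equivalent ![c₁, c₂]).symm.trans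
    (weightedSumSquares_equivalent_stdForm ?_ ?_ ?_)
  · intro i
    fin_cases i <;> simpa
  · rw [← ht]
    rcases h₁ with rfl | rfl <;> rcases h₂ with rfl | rfl <;> simp [-Finset.sum_boole, h]
  · rw [← hs]
    rcases h₁ with rfl | rfl <;> rcases h₂ with rfl | rfl <;> simp [-Finset.sum_boole, h, h']

end QuadraticForm

theorem nonempty_cliffordAlgebra_equiv {E F : Type*} [AddCommGroup E] [Module ℝ E]
    [AddCommGroup F] [Module ℝ F] {Q : QuadraticForm ℝ E} {Q' : QuadraticForm ℝ F}
    (h : Q.Equivalent Q') : Nonempty (CliffordAlgebra Q ≃ₐ[ℝ] CliffordAlgebra Q') :=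
  h.map equivOfIsometry

/-- Sylvester's law of inertia: a nondegenerate real form is isometric to the standard form of
its signature. -/
theorem equivalent_stdForm {E : Type*} [AddCommGroup E] [Module ℝ E] [FiniteDimensional ℝ E]
    (Q : QuadraticForm ℝ E) (hQ : (QuadraticMap.associated (R := ℝ) Q).Nondegenerate) :
    Q.Equivalent (stdForm (sigPos Q) (sigNeg Q)) := by
  classical
  obtain ⟨w, hw, e⟩ := QuadraticForm.equivalent_one_neg_one_weighted_sum_squared Q hQ.1
  refine e.trans (weightedSumSquares_equivalent_stdForm (fun i => (hw i).symm) ?_ ?_)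
  · rw [QuadraticForm.sigPos_of_equiv_weightedSumSquares e, ← Finset.card_filter,
      ← Set.ncard_coe_finset]
    congr 1
    ext i
    rcases hw i with h | h <;> norm_num [h]
  · rw [QuadraticForm.sigNeg_of_equiv_weightedSumSquares e, ← Finset.card_filter,
      ← Set.ncard_coe_finset]
    congr 1
    ext i
    rcases hw i with h | h <;> norm_num [h]

/-! ### Matrix algebras and tensor products -/

section Matrices

/-- The isomorphism of the split quaternion algebra `⟨i, j | i² = 1, j² = c, ij = -ji⟩` with the
`2 × 2` matrices given by `i ↦ diag(1, -1)` and `j ↦ !![0, c; 1, 0]`. -/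
noncomputable def splitQuaternionEquiv (c : ℝ) (hc : c * c = 1) : ℍ[ℝ,1,0,c] ≃ₐ[ℝ] Mat 2 ℝ :=
  AlgEquiv.ofLinearEquiv
    { toFun := fun x => !![x.re + x.imI, c * (x.imJ + x.imK); x.imJ - x.imK, x.re - x.imI]
      map_add' := fun x y => by
        ext i j; fin_cases i <;> fin_cases j <;> simp <;> ring
      map_smul' := fun r x => by
        ext i j; fin_cases i <;> fin_cases j <;> simp <;> ring
      invFun := fun A => ⟨(A 0 0 + A 1 1) / 2, (A 0 0 - A 1 1) / 2, (c * A 0 1 + A 1 0) / 2,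
        (c * A 0 1 - A 1 0) / 2⟩
      left_inv := fun x => by
        ext <;> simp [← mul_assoc, hc]
      right_inv := fun A => by
        ext i j; fin_cases i <;> fin_cases j <;> simp <;> ring_nf
        all_goals simp [pow_two, hc] }
    (by ext i j; fin_cases i <;> fin_cases j <;> simp)
    (fun x y => by
      ext i j; fin_cases i <;> fin_cases j <;> simp [Matrix.mul_apply] <;> grind)

variable {F : Type} [Ring F] [Algebra ℝ F]

/-- `Mₘ(F) ⊗ Mₙ(ℝ) ≅ M_{mn}(F)`. -/
noncomputable def matTensorEquiv (m n k : ℕ) (h : m * n = k) : Mat m F ⊗[ℝ] Mat n ℝ ≃ₐ[ℝ] Mat k F :=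
  ((Matrix.kroneckerTMulAlgEquiv (Fin m) (Fin n) ℝ ℝ F ℝ).trans
    (Algebra.TensorProduct.rid ℝ ℝ F).mapMatrix).trans
    (Matrix.reindexAlgEquiv ℝ F (finProdFinEquiv.trans (finCongr h)))

/-- Tensor products of algebras distribute over binary products on the left. -/
noncomputable def prodTensorEquiv (A B C : Type*) [Ring A] [Ring B] [Ring C] [Algebra ℝ A]
    [Algebra ℝ B] [Algebra ℝ C] : (A × B) ⊗[ℝ] C ≃ₐ[ℝ] (A ⊗[ℝ] C) × (B ⊗[ℝ] C) :=
  ((Algebra.TensorProduct.comm ℝ (A × B) C).trans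
    (Algebra.TensorProduct.prodRight ℝ ℝ C A B)).trans
    ((Algebra.TensorProduct.comm ℝ C A).prodCongr (Algebra.TensorProduct.comm ℝ C B))

/-- The two right factors of a triple tensor product of algebras can be swapped. -/
noncomputable def tensorRightCommEquiv (A B C : Type*) [Ring A] [Ring B] [Ring C] [Algebra ℝ A]
    [Algebra ℝ B] [Algebra ℝ C] : (A ⊗[ℝ] B) ⊗[ℝ] C ≃ₐ[ℝ] (A ⊗[ℝ] C) ⊗[ℝ] B :=
  ((Algebra.TensorProduct.assoc ℝ ℝ ℝ A B C).trans (Algebra.TensorProduct.congr AlgEquiv.refl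
    (Algebra.TensorProduct.comm ℝ B C))).trans (Algebra.TensorProduct.assoc ℝ ℝ ℝ A C B).symm

/-- Every algebra is its own algebra of `1 × 1` matrices. -/
def matOneEquiv : F ≃ₐ[ℝ] Mat 1 F :=
  AlgEquiv.ofLinearEquiv
    { toFun := fun x => Matrix.of fun _ _ => x
      map_add' := fun _ _ => rfl
      map_smul' := fun _ _ => rfl
      invFun := fun A => A 0 0
      left_inv := fun _ => rfl
      right_inv := fun A => by
        ext i j
        rw [Subsingleton.elim i 0, Subsingleton.elim j 0]
        rfl }
    (by
      ext i j
      rw [Subsingleton.elim i j, Matrix.one_apply_eq]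
      rfl)
    (fun x y => by
      ext i j
      simp only [Matrix.mul_apply, Fin.sum_univ_one]
      rfl)

end Matrices

/-! ### Clifford algebras in dimension at most two -/

section SmallCases

theorem nonempty_realClifford_zero_zero : Nonempty (RealClifford 0 0 ≃ₐ[ℝ] ℝ) := by
  have h : (stdForm 0 0).Equivalent (0 : QuadraticForm ℝ Unit) :=
    ⟨{ LinearEquiv.ofSubsingleton (Fin 0 ⊕ Fin 0 → ℝ) Unit with
      map_app' := fun v => by simp [stdForm] }⟩
  obtain ⟨e⟩ := nonempty_cliffordAlgebra_equiv h
  exact ⟨e.trans CliffordAlgebraRing.equiv⟩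

/-- For `e² = 1`, the algebra map from `ℝ × ℝ` sending the two primitive idempotents to
`(1 + e) / 2` and `(1 - e) / 2`. -/
noncomputable def ofProdOfSqEqOne {A : Type*} [Ring A] [Algebra ℝ A] (e : A) (he : e * e = 1) :
    ℝ × ℝ →ₐ[ℝ] A :=
  AlgHom.ofLinearMap
    ((LinearMap.fst ℝ ℝ ℝ).smulRight ((1 / 2 : ℝ) • (1 + e)) +
      (LinearMap.snd ℝ ℝ ℝ).smulRight ((1 / 2 : ℝ) • (1 - e)))
    (by
      simp only [LinearMap.add_apply, LinearMap.smulRight_apply, LinearMap.fst_apply,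
        LinearMap.snd_apply, Prod.fst_one, Prod.snd_one]
      module)
    (fun x y => by
      simp only [LinearMap.add_apply, LinearMap.smulRight_apply, LinearMap.fst_apply,
        LinearMap.snd_apply, Prod.fst_mul, Prod.snd_mul, add_mul, mul_add, smul_mul_smul_comm,
        sub_mul, mul_sub, he, one_mul, mul_one]
      module)

theorem nonempty_realClifford_one_zero : Nonempty (RealClifford 1 0 ≃ₐ[ℝ] ℝ × ℝ) := by
  let u : Unique (Fin 1 ⊕ Fin 0) := (Equiv.sumEmpty (Fin 1) (Fin 0)).unique
  have hu : (default : Fin 1 ⊕ Fin 0) = Sum.inl 0 := rfl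
  have h : (stdForm 1 0).Equivalent (QuadraticMap.sq (R := ℝ)) :=
    ⟨{ LinearEquiv.funUnique (Fin 1 ⊕ Fin 0) ℝ ℝ with
      map_app' := fun v => by simp [stdForm, hu] }⟩
  obtain ⟨e⟩ := nonempty_cliffordAlgebra_equiv h
  have he : ι (QuadraticMap.sq (R := ℝ)) 1 * ι (QuadraticMap.sq (R := ℝ)) 1 = 1 := by
    simp [ι_sq_scalar]
  let f : CliffordAlgebra (QuadraticMap.sq (R := ℝ)) →ₐ[ℝ] ℝ × ℝ :=
    lift _ ⟨LinearMap.prod LinearMap.id (-LinearMap.id), fun v => by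
      ext <;> simp⟩
  have hf : f (ι _ 1) = (1, -1) := by
    rw [lift_ι_apply]
    rfl
  refine ⟨e.trans (AlgEquiv.ofAlgHom f (ofProdOfSqEqOne _ he) ?_ ?_)⟩
  · apply AlgHom.ext
    rintro ⟨a, b⟩
    ext <;> simp [ofProdOfSqEqOne, hf] <;> ring
  · ext
    simp only [LinearMap.comp_apply, AlgHom.toLinearMap_apply, AlgHom.comp_apply, hf,
      AlgHom.id_apply]
    simp only [ofProdOfSqEqOne, AlgHom.ofLinearMap_apply, LinearMap.add_apply,
      LinearMap.smulRight_apply, LinearMap.fst_apply, LinearMap.snd_apply]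
    module

theorem nonempty_realClifford_two_zero : Nonempty (RealClifford 2 0 ≃ₐ[ℝ] Mat 2 ℝ) := by
  obtain ⟨e⟩ := nonempty_cliffordAlgebra_equiv
    (quaternionForm_equivalent_stdForm (c₁ := 1) (c₂ := 1) (t := 2) (s := 0)
      (by norm_num) (by norm_num) (by norm_num) (by norm_num))
  exact ⟨(e.symm.trans CliffordAlgebraQuaternion.equiv).trans
    (splitQuaternionEquiv 1 (by norm_num))⟩

theorem nonempty_realClifford_one_one : Nonempty (RealClifford 1 1 ≃ₐ[ℝ] Mat 2 ℝ) := by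
  obtain ⟨e⟩ := nonempty_cliffordAlgebra_equiv
    (quaternionForm_equivalent_stdForm (c₁ := 1) (c₂ := -1) (t := 1) (s := 1)
      (by norm_num) (by norm_num) (by norm_num) (by norm_num))
  exact ⟨(e.symm.trans CliffordAlgebraQuaternion.equiv).trans
    (splitQuaternionEquiv (-1) (by norm_num))⟩

theorem nonempty_realClifford_zero_two : Nonempty (RealClifford 0 2 ≃ₐ[ℝ] ℍ[ℝ]) := by
  obtain ⟨e⟩ := nonempty_cliffordAlgebra_equiv
    (quaternionForm_equivalent_stdForm (c₁ := -1) (c₂ := -1) (t := 0) (s := 2)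
      (by norm_num) (by norm_num) (by norm_num) (by norm_num))
  exact ⟨e.symm.trans CliffordAlgebraQuaternion.equiv⟩

theorem nonempty_realClifford_zero_one : Nonempty (RealClifford 0 1 ≃ₐ[ℝ] ℂ) := by
  let u : Unique (Fin 0 ⊕ Fin 1) := (Equiv.emptySum (Fin 0) (Fin 1)).unique
  have h : (stdForm 0 1).Equivalent CliffordAlgebraComplex.Q :=
    ⟨{ LinearEquiv.funUnique (Fin 0 ⊕ Fin 1) ℝ ℝ with
      map_app' := fun v => by
        simp [stdForm]
        exact (neg_one_mul (_ : ℝ)).symm }⟩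
  obtain ⟨e⟩ := nonempty_cliffordAlgebra_equiv h
  exact ⟨e.trans CliffordAlgebraComplex.equiv⟩

end SmallCases

/-! ### Splitting off planes, and periodicity -/

section Recursion

/-- Splitting off a plane with entries `±1`, in terms of standard forms. -/
theorem nonempty_realClifford_of_plane {c₁ c₂ : ℝ} (h₁ : c₁ = 1 ∨ c₁ = -1)
    (h₂ : c₂ = 1 ∨ c₂ = -1) {a b t s : ℕ}
    (h : ((CliffordAlgebraQuaternion.Q c₁ c₂).prod ((-(c₁ * c₂)) • stdForm a b)).Equivalent
      (stdForm t s)) :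
    Nonempty (RealClifford t s ≃ₐ[ℝ] RealClifford a b ⊗[ℝ] ℍ[ℝ,c₁,0,c₂]) := by
  obtain ⟨e⟩ := nonempty_cliffordAlgebra_equiv h
  have hc : (c₁ * c₂) * (c₁ * c₂) = 1 := by
    rcases h₁ with rfl | rfl <;> rcases h₂ with rfl | rfl <;> norm_num
  exact ⟨(e.symm.trans (CliffordPlane.sumFormEquiv _ hc)).trans
    (Algebra.TensorProduct.congr AlgEquiv.refl CliffordAlgebraQuaternion.equiv)⟩

variable (t s : ℕ)

theorem nonempty_realClifford_succ_succ :
    Nonempty (RealClifford (t + 1) (s + 1) ≃ₐ[ℝ] RealClifford t s ⊗[ℝ] Mat 2 ℝ) := by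
  obtain ⟨e⟩ := nonempty_realClifford_of_plane (c₁ := 1) (c₂ := -1) (a := t) (b := s)
    (t := t + 1) (s := s + 1) (by norm_num) (by norm_num)
    (prod_smul_stdForm_equivalent (by norm_num) (by norm_num) (by norm_num) _ _
      (by norm_num [add_comm]) (by norm_num [add_comm]))
  exact ⟨e.trans (Algebra.TensorProduct.congr AlgEquiv.refl
    (splitQuaternionEquiv (-1) (by norm_num)))⟩

theorem nonempty_realClifford_add_two_left :
    Nonempty (RealClifford (t + 2) s ≃ₐ[ℝ] RealClifford s t ⊗[ℝ] Mat 2 ℝ) := by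
  obtain ⟨e⟩ := nonempty_realClifford_of_plane (c₁ := 1) (c₂ := 1) (a := s) (b := t)
    (t := t + 2) (s := s) (by norm_num) (by norm_num)
    (prod_smul_stdForm_equivalent (by norm_num) (by norm_num) (by norm_num) _ _
      (by norm_num [add_comm]) (by norm_num))
  exact ⟨e.trans (Algebra.TensorProduct.congr AlgEquiv.refl
    (splitQuaternionEquiv 1 (by norm_num)))⟩

theorem nonempty_realClifford_add_two_right :
    Nonempty (RealClifford t (s + 2) ≃ₐ[ℝ] RealClifford s t ⊗[ℝ] ℍ[ℝ]) :=
  nonempty_realClifford_of_plane (c₁ := -1) (c₂ := -1) (a := s) (b := t)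
    (t := t) (s := s + 2) (by norm_num) (by norm_num)
    (prod_smul_stdForm_equivalent (by norm_num) (by norm_num) (by norm_num) _ _
      (by norm_num) (by norm_num [add_comm]))

/-- Both algebras are `C_{t,s} ⊗ ℍ ⊗ M₂(ℝ)`: split off a positive definite and a negative
definite plane, in either order. -/
theorem nonempty_realClifford_add_four :
    Nonempty (RealClifford (t + 4) s ≃ₐ[ℝ] RealClifford t (s + 4)) := by
  obtain ⟨e₁⟩ := nonempty_realClifford_add_two_left (t + 2) s
  obtain ⟨e₂⟩ := nonempty_realClifford_add_two_right s t
  obtain ⟨e₃⟩ := nonempty_realClifford_add_two_right t (s + 2)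
  obtain ⟨e₄⟩ := nonempty_realClifford_add_two_left s t
  exact ⟨((e₁.trans (Algebra.TensorProduct.congr e₂ AlgEquiv.refl)).trans
    (tensorRightCommEquiv _ _ _)).trans
    (e₃.trans (Algebra.TensorProduct.congr e₄ AlgEquiv.refl)).symm⟩

theorem nonempty_realClifford_add_add (k : ℕ) :
    Nonempty (RealClifford (t + k) (s + k) ≃ₐ[ℝ] RealClifford t s ⊗[ℝ] Mat (2 ^ k) ℝ) := by
  induction k with
  | zero =>
    exact ⟨(Algebra.TensorProduct.rid ℝ ℝ _).symm.trans
      (Algebra.TensorProduct.congr AlgEquiv.refl matOneEquiv)⟩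
  | succ k ih =>
    obtain ⟨e⟩ := ih
    obtain ⟨e'⟩ := nonempty_realClifford_succ_succ (t + k) (s + k)
    exact ⟨((e'.trans (Algebra.TensorProduct.congr e AlgEquiv.refl)).trans
      (Algebra.TensorProduct.assoc ℝ ℝ ℝ _ _ _)).trans
      (Algebra.TensorProduct.congr AlgEquiv.refl (matTensorEquiv _ _ _ (pow_succ 2 k).symm))⟩

theorem nonempty_realClifford_add_eight_left :
    Nonempty (RealClifford (t + 8) s ≃ₐ[ℝ] RealClifford t s ⊗[ℝ] Mat 16 ℝ) := by
  obtain ⟨e⟩ := nonempty_realClifford_add_four (t + 4) s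
  obtain ⟨e'⟩ := nonempty_realClifford_add_add t s 4
  exact ⟨e.trans e'⟩

theorem nonempty_realClifford_add_eight_right :
    Nonempty (RealClifford t (s + 8) ≃ₐ[ℝ] RealClifford t s ⊗[ℝ] Mat 16 ℝ) := by
  obtain ⟨e⟩ := nonempty_realClifford_add_four t (s + 4)
  obtain ⟨e'⟩ := nonempty_realClifford_add_add t s 4
  exact ⟨e.symm.trans e'⟩

end Recursion

/-! ### The table -/

section Table

/-- The row `r` modulo `8` of the table of real Clifford algebras: the algebra `A` is the entry
of that row for the given `ℓ`. -/
def IsTableEntry (A : Type) [Ring A] [Algebra ℝ A] (r : ℤ) (ℓ : ℕ) : Prop :=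
  (r % 8 = 0 → Nonempty (A ≃ₐ[ℝ] Mat (2 ^ ℓ) ℝ)) ∧
  (r % 8 = 1 → Nonempty (A ≃ₐ[ℝ] Mat (2 ^ ℓ) ℝ × Mat (2 ^ ℓ) ℝ)) ∧
  (r % 8 = 2 → Nonempty (A ≃ₐ[ℝ] Mat (2 ^ ℓ) ℝ)) ∧
  (r % 8 = 3 → Nonempty (A ≃ₐ[ℝ] Mat (2 ^ ℓ) ℂ)) ∧
  (r % 8 = 4 → 1 ≤ ℓ ∧ Nonempty (A ≃ₐ[ℝ] Mat (2 ^ (ℓ - 1)) ℍ[ℝ])) ∧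
  (r % 8 = 5 → 1 ≤ ℓ ∧
    Nonempty (A ≃ₐ[ℝ] Mat (2 ^ (ℓ - 1)) ℍ[ℝ] × Mat (2 ^ (ℓ - 1)) ℍ[ℝ])) ∧
  (r % 8 = 6 → 1 ≤ ℓ ∧ Nonempty (A ≃ₐ[ℝ] Mat (2 ^ (ℓ - 1)) ℍ[ℝ])) ∧
  (r % 8 = 7 → Nonempty (A ≃ₐ[ℝ] Mat (2 ^ ℓ) ℂ))

variable {A B : Type} [Ring A] [Algebra ℝ A] [Ring B] [Algebra ℝ B]

theorem nonempty_mat_succ {F : Type} [Ring F] [Algebra ℝ F] {k m : ℕ} (hm : m = k + 1)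
    (e : A ≃ₐ[ℝ] B ⊗[ℝ] Mat 2 ℝ) (h : Nonempty (B ≃ₐ[ℝ] Mat (2 ^ k) F)) :
    Nonempty (A ≃ₐ[ℝ] Mat (2 ^ m) F) := by
  obtain ⟨f⟩ := h
  exact ⟨(e.trans (Algebra.TensorProduct.congr f AlgEquiv.refl)).trans
    (matTensorEquiv _ _ _ (by rw [hm, pow_succ]))⟩

theorem nonempty_mat_prod_succ {F : Type} [Ring F] [Algebra ℝ F] {k m : ℕ} (hm : m = k + 1)
    (e : A ≃ₐ[ℝ] B ⊗[ℝ] Mat 2 ℝ) (h : Nonempty (B ≃ₐ[ℝ] Mat (2 ^ k) F × Mat (2 ^ k) F)) :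
    Nonempty (A ≃ₐ[ℝ] Mat (2 ^ m) F × Mat (2 ^ m) F) := by
  obtain ⟨f⟩ := h
  have g : Mat (2 ^ k) F ⊗[ℝ] Mat 2 ℝ ≃ₐ[ℝ] Mat (2 ^ m) F :=
    matTensorEquiv _ _ _ (by rw [hm, pow_succ])
  exact ⟨((e.trans (Algebra.TensorProduct.congr f AlgEquiv.refl)).trans
    (prodTensorEquiv _ _ _)).trans (g.prodCongr g)⟩

namespace IsTableEntry

theorem tensor_mat {r : ℤ} {ℓ : ℕ} (h : IsTableEntry B r ℓ) (e : A ≃ₐ[ℝ] B ⊗[ℝ] Mat 2 ℝ) :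
    IsTableEntry A r (ℓ + 1) := by
  obtain ⟨h₀, h₁, h₂, h₃, h₄, h₅, h₆, h₇⟩ := h
  refine ⟨fun hr => nonempty_mat_succ rfl e (h₀ hr), fun hr => nonempty_mat_prod_succ rfl e (h₁ hr),
    fun hr => nonempty_mat_succ rfl e (h₂ hr), fun hr => nonempty_mat_succ rfl e (h₃ hr),
    fun hr => ⟨by omega, ?_⟩, fun hr => ⟨by omega, ?_⟩, fun hr => ⟨by omega, ?_⟩,
    fun hr => nonempty_mat_succ rfl e (h₇ hr)⟩
  · obtain ⟨hl, h⟩ := h₄ hr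
    exact nonempty_mat_succ (by omega) e h
  · obtain ⟨hl, h⟩ := h₅ hr
    exact nonempty_mat_prod_succ (by omega) e h
  · obtain ⟨hl, h⟩ := h₆ hr
    exact nonempty_mat_succ (by omega) e h

theorem congr {r r' : ℤ} {ℓ ℓ' : ℕ} (h : IsTableEntry B r ℓ) (e : A ≃ₐ[ℝ] B)
    (hr : r' % 8 = r % 8) (hℓ : ℓ' = ℓ) : IsTableEntry A r' ℓ' := by
  subst hℓ
  obtain ⟨h₀, h₁, h₂, h₃, h₄, h₅, h₆, h₇⟩ := h
  rw [← hr] at h₀ h₁ h₂ h₃ h₄ h₅ h₆ h₇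
  exact ⟨fun h => (h₀ h).map e.trans, fun h => (h₁ h).map e.trans, fun h => (h₂ h).map e.trans,
    fun h => (h₃ h).map e.trans, fun h => ⟨(h₄ h).1, (h₄ h).2.map e.trans⟩,
    fun h => ⟨(h₅ h).1, (h₅ h).2.map e.trans⟩, fun h => ⟨(h₆ h).1, (h₆ h).2.map e.trans⟩,
    fun h => (h₇ h).map e.trans⟩

/-- The table is symmetric under `r ↦ 2 - r`. -/
theorem two_sub {r r' : ℤ} {ℓ : ℕ} (h : IsTableEntry A r ℓ) (hr : r' = 2 - r) :
    IsTableEntry A r' ℓ := by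
  obtain ⟨h₀, h₁, h₂, h₃, h₄, h₅, h₆, h₇⟩ := h
  exact ⟨fun h => h₂ (by omega), fun h => h₁ (by omega), fun h => h₀ (by omega),
    fun h => h₇ (by omega), fun h => h₆ (by omega), fun h => h₅ (by omega),
    fun h => h₄ (by omega), fun h => h₃ (by omega)⟩

end IsTableEntry

theorem isTableEntry_zero_zero : IsTableEntry (RealClifford 0 0) 0 0 := by
  obtain ⟨e⟩ := nonempty_realClifford_zero_zero
  exact ⟨fun _ => ⟨e.trans matOneEquiv⟩, by omega, by omega, by omega, by omega, by omega,
    by omega, by omega⟩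

theorem isTableEntry_one_zero : IsTableEntry (RealClifford 1 0) 1 0 := by
  obtain ⟨e⟩ := nonempty_realClifford_one_zero
  exact ⟨by omega, fun _ => ⟨e.trans (matOneEquiv.prodCongr matOneEquiv)⟩, by omega, by omega,
    by omega, by omega, by omega, by omega⟩

theorem isTableEntry_zero_one : IsTableEntry (RealClifford 0 1) (-1) 0 := by
  obtain ⟨e⟩ := nonempty_realClifford_zero_one
  exact ⟨by omega, by omega, by omega, by omega, by omega, by omega, by omega,
    fun _ => ⟨e.trans matOneEquiv⟩⟩

theorem isTableEntry_zero_two : IsTableEntry (RealClifford 0 2) (-2) 1 := by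
  obtain ⟨e⟩ := nonempty_realClifford_zero_two
  exact ⟨by omega, by omega, by omega, by omega, by omega, by omega,
    fun _ => ⟨le_rfl, ⟨e.trans matOneEquiv⟩⟩, by omega⟩

/-- `C_{0,3} ≅ C_{1,0} ⊗ ℍ ≅ (ℝ × ℝ) ⊗ ℍ ≅ ℍ × ℍ`. -/
theorem isTableEntry_zero_three : IsTableEntry (RealClifford 0 3) (-3) 1 := by
  obtain ⟨e⟩ := nonempty_realClifford_add_two_right 0 1
  obtain ⟨f⟩ := nonempty_realClifford_one_zero
  have g : ℝ ⊗[ℝ] ℍ[ℝ] ≃ₐ[ℝ] Mat (2 ^ 0) ℍ[ℝ] :=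
    (Algebra.TensorProduct.lid ℝ ℍ[ℝ]).trans matOneEquiv
  exact ⟨by omega, by omega, by omega, by omega, by omega,
    fun _ => ⟨le_rfl, ⟨((e.trans (Algebra.TensorProduct.congr f AlgEquiv.refl)).trans
      (prodTensorEquiv _ _ _)).trans (g.prodCongr g)⟩⟩, by omega, by omega⟩

theorem isTableEntry_succ_succ {t s : ℕ}
    (h : IsTableEntry (RealClifford t s) (t - s) ((t + s) / 2)) :
    IsTableEntry (RealClifford (t + 1) (s + 1)) ((t + 1 : ℕ) - (s + 1 : ℕ))
      ((t + 1 + (s + 1)) / 2) := by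
  obtain ⟨e⟩ := nonempty_realClifford_succ_succ t s
  exact (h.tensor_mat e).congr AlgEquiv.refl (by push_cast; congr 1; ring) (by omega)

theorem isTableEntry_add_two_left {t s : ℕ}
    (h : IsTableEntry (RealClifford s t) (s - t) ((s + t) / 2)) :
    IsTableEntry (RealClifford (t + 2) s) ((t + 2 : ℕ) - s) ((t + 2 + s) / 2) := by
  obtain ⟨e⟩ := nonempty_realClifford_add_two_left t s
  exact ((h.tensor_mat e).two_sub rfl).congr AlgEquiv.refl (by push_cast; congr 1; ring)
    (by omega)

theorem isTableEntry_add_four_right {t s : ℕ}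
    (h : IsTableEntry (RealClifford (t + 4) s) ((t + 4 : ℕ) - s) ((t + 4 + s) / 2)) :
    IsTableEntry (RealClifford t (s + 4)) (t - (s + 4 : ℕ)) ((t + (s + 4)) / 2) := by
  obtain ⟨e⟩ := nonempty_realClifford_add_four t s
  exact h.congr e.symm (by push_cast; omega) (by omega)

/-- Induction on `t + s`: hyperbolic planes reduce to a definite form; in the definite case
`C_{t+2,0}` comes from `C_{0,t}`, and `C_{0,s+4} ≅ C_{4,s}` contains a hyperbolic plane for `s ≥ 1`
and comes from `C_{0,2}` for `s = 0`. -/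
theorem isTableEntry_realClifford :
    ∀ t s : ℕ, IsTableEntry (RealClifford t s) (t - s) ((t + s) / 2)
  | t + 1, s + 1 => isTableEntry_succ_succ (isTableEntry_realClifford t s)
  | 0, 0 => isTableEntry_zero_zero
  | 1, 0 => isTableEntry_one_zero
  | t + 2, 0 => isTableEntry_add_two_left (isTableEntry_realClifford 0 t)
  | 0, 1 => isTableEntry_zero_one
  | 0, 2 => isTableEntry_zero_two
  | 0, 3 => isTableEntry_zero_three
  | 0, 4 => isTableEntry_add_four_right (isTableEntry_add_two_left isTableEntry_zero_two)
  | 0, s + 5 =>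
    isTableEntry_add_four_right (isTableEntry_succ_succ (isTableEntry_realClifford 3 s))
  termination_by t s => t + s

end Table

end

theorem mainTheorem2 :
    -- The table: the isomorphism type of `C_{t,s}` with `ℓ = ⌊(t + s) / 2⌋`.
    (∀ t s ℓ : ℕ, ℓ = (t + s) / 2 →
      (((t : ℤ) - (s : ℤ)) % 8 = 0 →
        Nonempty (RealClifford t s ≃ₐ[ℝ] Mat (2 ^ ℓ) ℝ)) ∧
      (((t : ℤ) - (s : ℤ)) % 8 = 1 →
        Nonempty (RealClifford t s ≃ₐ[ℝ] Mat (2 ^ ℓ) ℝ × Mat (2 ^ ℓ) ℝ)) ∧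
      (((t : ℤ) - (s : ℤ)) % 8 = 2 →
        Nonempty (RealClifford t s ≃ₐ[ℝ] Mat (2 ^ ℓ) ℝ)) ∧
      (((t : ℤ) - (s : ℤ)) % 8 = 3 →
        Nonempty (RealClifford t s ≃ₐ[ℝ] Mat (2 ^ ℓ) ℂ)) ∧
      (((t : ℤ) - (s : ℤ)) % 8 = 4 →
        1 ≤ ℓ ∧ Nonempty (RealClifford t s ≃ₐ[ℝ] Mat (2 ^ (ℓ - 1)) ℍ[ℝ])) ∧
      (((t : ℤ) - (s : ℤ)) % 8 = 5 →
        1 ≤ ℓ ∧ Nonempty (RealClifford t s ≃ₐ[ℝ]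
          Mat (2 ^ (ℓ - 1)) ℍ[ℝ] × Mat (2 ^ (ℓ - 1)) ℍ[ℝ])) ∧
      (((t : ℤ) - (s : ℤ)) % 8 = 6 →
        1 ≤ ℓ ∧ Nonempty (RealClifford t s ≃ₐ[ℝ] Mat (2 ^ (ℓ - 1)) ℍ[ℝ])) ∧
      (((t : ℤ) - (s : ℤ)) % 8 = 7 →
        Nonempty (RealClifford t s ≃ₐ[ℝ] Mat (2 ^ ℓ) ℂ))) ∧
    -- Every nondegenerate real quadratic form of signature `(t, s)` has Clifford algebra `C_{t,s}`.
    (∀ (E : Type*) [AddCommGroup E] [Module ℝ E] [FiniteDimensional ℝ E]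
      (Q : QuadraticForm ℝ E), (QuadraticMap.associated (R := ℝ) Q).Nondegenerate →
        Nonempty (CliffordAlgebra Q ≃ₐ[ℝ] RealClifford (sigPos Q) (sigNeg Q))) ∧
    -- The small cases.
    (Nonempty (RealClifford 0 0 ≃ₐ[ℝ] ℝ) ∧
      Nonempty (RealClifford 1 0 ≃ₐ[ℝ] ℝ × ℝ) ∧
      Nonempty (RealClifford 0 1 ≃ₐ[ℝ] ℂ) ∧
      Nonempty (RealClifford 2 0 ≃ₐ[ℝ] Mat 2 ℝ) ∧
      Nonempty (RealClifford 1 1 ≃ₐ[ℝ] Mat 2 ℝ) ∧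
      Nonempty (RealClifford 0 2 ≃ₐ[ℝ] ℍ[ℝ])) ∧
    -- Periodicity.
    (∀ d : ℕ,
      Nonempty (RealClifford (d + 8) 0 ≃ₐ[ℝ] RealClifford d 0 ⊗[ℝ] Mat 16 ℝ) ∧
      Nonempty (RealClifford 0 (d + 8) ≃ₐ[ℝ] RealClifford 0 d ⊗[ℝ] Mat 16 ℝ)) ∧
    -- Reduction of the signature `(t, s)` with `t ≥ s` to the definite signature `(t - s, 0)`.
    (∀ t s : ℕ, s ≤ t →
      Nonempty (RealClifford t s ≃ₐ[ℝ] RealClifford (t - s) 0 ⊗[ℝ] Mat (2 ^ s) ℝ)) := by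
  refine ⟨?_, ?_, ?_, ?_, ?_⟩
  · rintro t s ℓ rfl
    exact isTableEntry_realClifford t s
  · intro E _ _ _ Q hQ
    exact nonempty_cliffordAlgebra_equiv (equivalent_stdForm Q hQ)
  · exact ⟨nonempty_realClifford_zero_zero, nonempty_realClifford_one_zero,
      nonempty_realClifford_zero_one, nonempty_realClifford_two_zero,
      nonempty_realClifford_one_one, nonempty_realClifford_zero_two⟩
  · exact fun d => ⟨nonempty_realClifford_add_eight_left d 0,
      nonempty_realClifford_add_eight_right 0 d⟩
  · intro t s hst
    obtain ⟨e⟩ := nonempty_realClifford_add_add (t - s) 0 s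
    rw [Nat.sub_add_cancel hst, Nat.zero_add] at e
    exact ⟨e⟩
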